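/- For positive integers $s_1,\dots,s_l$ with $s_l>1$ let $$\zeta(s_1,\dots,s_l)=\sum_{1\le k_1<k_2<\cdots<k_l}\frac{1}{k_1^{s_1}k_2^{s_2}\cdots k_l^{s_l}}$$ be the multiple zeta value, with $\zeta(\emptyset)=1$ for the empty index; let $\{2\}^d$ denote the sequence $2,\dots,2$ of length $d$, and for integers $r,s\ge 0$ put $H(r,s)=\zeta(\{2\}^r,3,\{2\}^s)$. Then for all integers $r,s\ge 0$ (all the series involved being convergent) $$H(r,s)=2\sum_{k=1}^{r+s+1}(-1)^k\,c^{(k)}_{r,s}\,\zeta(2k+1)\,\zeta(\{2\}^{r+s+1-k}),$$ where $\zeta(2k+1)$ is the value of the Riemann zeta function and $$c^{(k)}_{r,s}=\binom{2k}{2r+2}-\Bigl(1-\frac{1}{2^{2k}}\Bigr)\binom{2k}{2s+1}.$$ -/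

import Mathlib

/-- The strictly increasing sequences `1 ≤ k₁ < k₂ < ⋯ < k_l` of integers. -/
def IncrTuple (l : ℕ) : Type :=
  {k : Fin l → ℕ // StrictMono k ∧ ∀ i, 1 ≤ k i}

/-- The term `1 / (k₁ ^ s₁ * ⋯ * k_l ^ s_l)` of the multiple zeta series with index `s`. -/
noncomputable def mzvTerm (s : List ℕ) (k : IncrTuple s.length) : ℝ :=
  1 / ∏ i : Fin s.length, (k.1 i : ℝ) ^ s.get i

/-- The multiple zeta value `ζ(s₁, …, s_l)`, the sum over `1 ≤ k₁ < ⋯ < k_l`. For the empty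
index there is exactly one (empty) tuple and the value is `1`. -/
noncomputable def mzv (s : List ℕ) : ℝ :=
  ∑' k : IncrTuple s.length, mzvTerm s k

/-- The index `({2}^d)`. -/
def twos (d : ℕ) : List ℕ := List.replicate d 2

/-- The index `({2}^r, 3, {2}^s)`. -/
def hIndex (r s : ℕ) : List ℕ := twos r ++ 3 :: twos s

/-- `H(r, s) = ζ({2}^r, 3, {2}^s)`. -/
noncomputable def zagierH (r s : ℕ) : ℝ := mzv (hIndex r s)

/-- The coefficient `c^{(k)}_{r,s}`. -/
def zagierCoeff (k r s : ℕ) : ℚ :=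
  ((2 * k).choose (2 * r + 2) : ℚ) - (1 - 1 / 2 ^ (2 * k)) * ((2 * k).choose (2 * s + 1) : ℚ)

/-! The tails of the series, over tuples with all entries above `N`, have integral representations.
With `sinPow N` the multiple of `sin ^ (2N)` of mean 1 on `[0, π/2]`, one has `(sinPow (N+1))'' =
4(N+1)²(sinPow N - sinPow (N+1))`. Two integrations by parts against `(π-2x)^(2b)/(2b)!` turn this
into the recursion in `N` of the tails of `ζ({2}^b)` (`twosTail_sub`); since both sides tend to 0,
they agree.

For the entry 3, multiplying by `cot x` supplies an extra factor `1/n`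
(`integral_sinPow_mul_cotWeight`). Each entry 2 to its left, and the remaining `1/n²` of the 3,
comes from a double primitive of `sinPow N` (`iterSinPow_sub`). At `N = 0` everything is polynomial,
so that (`hasSum_tailTerm_hIndex`) `H(r,s) = (2/π) ∫ (2x)^(2r+2)/(2r+2)! · (π-2x)^(2s+1)/(2s+1)! ·
cot x dx` over `[0, π/2]`.

Expanding `cot x = 2 ∑ sin 2nx`, justified by Riemann-Lebesgue, and integrating by parts leaves even
derivatives of the polynomial at the endpoints (`integral_eval_mul_cot`). Those at 0 multiply
`ζ(2k+1)`, those at `π` its alternating analogue, whence the factor `1 - 2^(-2k)`; the derivatives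
themselves are binomial coefficients times `π^(2d+1)/(2d+1)! = π ζ({2}^d)`. -/

section

open Filter Topology Real MeasureTheory intervalIntegral
open Nat (factorial)

/-! ### Summation over increasing tuples, smallest entry first. -/

/-- The strictly increasing sequences of integers with all entries larger than `N`. -/
def TupleAbove (N l : ℕ) : Type :=
  {k : Fin l → ℕ // StrictMono k ∧ ∀ i, N + 1 ≤ k i}

/-- The term of the multiple zeta series with index `s`, on tuples above `N`. -/
noncomputable def tailTerm (N : ℕ) (s : List ℕ) (k : TupleAbove N s.length) : ℝ :=
  1 / ∏ i : Fin s.length, (k.1 i : ℝ) ^ s.get i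

lemma tailTerm_nonneg (N : ℕ) (s : List ℕ) (k : TupleAbove N s.length) : 0 ≤ tailTerm N s k := by
  unfold tailTerm; positivity

/-- Prepend the entry `N + 1 + m` to a tuple above `N + 1 + m`. -/
def TupleAbove.cons (N l : ℕ) (x : Σ m : ℕ, TupleAbove (N + 1 + m) l) : TupleAbove N (l + 1) :=
  ⟨Fin.cons (N + 1 + x.1) x.2.1, by
    refine ⟨Fin.strictMono_iff_lt_succ.2 fun i => ?_, fun i => ?_⟩
    · obtain ⟨m, k, hk, hN⟩ := x
      cases l with
      | zero => exact i.elim0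
      | succ l =>
        refine Fin.cases ?_ (fun j => ?_) i
        · exact hN 0
        · rw [← Fin.succ_castSucc, Fin.cons_succ, Fin.cons_succ]
          exact hk Fin.castSucc_lt_succ
    · refine Fin.cases ?_ (fun j => ?_) i
      · simp only [Fin.cons_zero]; omega
      · have := x.2.2.2 j
        simp only [Fin.cons_succ]; omega⟩

lemma TupleAbove.cons_bijective (N l : ℕ) : Function.Bijective (TupleAbove.cons N l) := by
  constructor
  · rintro ⟨m, k, hk⟩ ⟨m', k', hk'⟩ h
    have h' := congrArg Subtype.val h
    simp only [TupleAbove.cons] at h'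
    have h0 := congrFun h' 0
    simp only [Fin.cons_zero] at h0
    obtain rfl : m = m' := by omega
    have : k = k' := by
      funext j
      simpa using congrFun h' j.succ
    subst this
    rfl
  · rintro ⟨k, hk, hN⟩
    have h0 := hN 0
    refine ⟨⟨k 0 - (N + 1), Fin.tail k, ?_, fun i => ?_⟩, ?_⟩
    · exact fun i j hij => hk (Fin.succ_lt_succ_iff.2 hij)
    · have : k 0 < k i.succ := hk (Fin.succ_pos i)
      simp only [Fin.tail]; omega
    · apply Subtype.ext
      have : N + 1 + (k 0 - (N + 1)) = k 0 := by omega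
      simp only [TupleAbove.cons, this, Fin.cons_self_tail]

lemma hasSum_tailTerm_nil (N : ℕ) : HasSum (tailTerm N []) 1 := by
  have : Unique (TupleAbove N ([] : List ℕ).length) :=
    { default := ⟨fun i => i.elim0, fun i => i.elim0, fun i => i.elim0⟩
      uniq := fun a => Subtype.ext (funext fun i => i.elim0) }
  have h := hasSum_unique (tailTerm N [])
  simpa [tailTerm] using h

/-- Fixing the smallest entry leaves a tail sum above that entry; nonnegativity of the terms makes
the iterated sum legitimate. -/
lemma hasSum_tailTerm_cons {N a : ℕ} {s : List ℕ} {f : ℕ → ℝ} {v : ℝ}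
    (hf : ∀ n, N < n → HasSum (tailTerm n s) (f n))
    (hv : HasSum (fun m : ℕ => f (N + 1 + m) / ((N + 1 + m : ℕ) : ℝ) ^ a) v) :
    HasSum (tailTerm N (a :: s)) v := by
  let e : (Σ m : ℕ, TupleAbove (N + 1 + m) s.length) ≃ TupleAbove N (a :: s).length :=
    Equiv.ofBijective _ (TupleAbove.cons_bijective N s.length)
  have key : ∀ x : Σ m : ℕ, TupleAbove (N + 1 + m) s.length,
      (tailTerm N (a :: s) ∘ e) x
        = tailTerm (N + 1 + x.1) s x.2 / ((N + 1 + x.1 : ℕ) : ℝ) ^ a := by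
    intro x
    change 1 / ∏ i : Fin (s.length + 1), _ = _
    rw [Fin.prod_univ_succ]
    simp only [tailTerm, e, Equiv.ofBijective_apply, TupleAbove.cons, Fin.cons_zero, Fin.cons_succ,
      List.get_cons_zero, List.get_cons_succ']
    rw [div_div, mul_comm]
  have hfib : ∀ m : ℕ, HasSum (fun c => (tailTerm N (a :: s) ∘ e) ⟨m, c⟩)
      (f (N + 1 + m) / ((N + 1 + m : ℕ) : ℝ) ^ a) := by
    intro m
    simp only [key]
    exact (hf _ (by omega)).div_const _
  rw [← e.hasSum_iff]
  refine HasSum.sigma_of_hasSum hv hfib ?_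
  have hnn : ∀ x, 0 ≤ (tailTerm N (a :: s) ∘ e) x := fun x => tailTerm_nonneg _ _ _
  refine (summable_sigma_of_nonneg hnn).2 ⟨fun m => (hfib m).summable, ?_⟩
  simp only [(hfib _).tsum_eq]
  exact hv.summable

/-- A sequence tending to zero is the sum of its successive differences. -/
lemma hasSum_of_sub_eq {g t : ℕ → ℝ} (hg : Tendsto g atTop (𝓝 0)) (ht : ∀ n, 0 ≤ t n)
    (h : ∀ n, g n - g (n + 1) = t (n + 1)) (N : ℕ) : HasSum (fun m => t (N + 1 + m)) (g N) := by
  rw [hasSum_iff_tendsto_nat_of_nonneg (fun m => ht _)]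
  have h1 : ∀ n, ∑ i ∈ Finset.range n, t (N + 1 + i) = g N - g (N + n) := by
    intro n
    have := Finset.sum_range_sub' (fun i => g (N + i)) n
    rw [add_zero] at this
    rw [← this]
    refine Finset.sum_congr rfl fun i _ => ?_
    rw [show N + 1 + i = N + i + 1 by ring, ← h]; rfl
  simp only [h1]
  have h2 : Tendsto (fun n => g (N + n)) atTop (𝓝 0) := by
    simpa [add_comm] using (tendsto_add_atTop_iff_nat N).2 hg
  simpa using h2.const_sub (g N)

/-! ### Powers of the sine and the tails of `ζ({2}^d)`. -/

/-- The ratio `4 ^ k / (2k choose k)`, given by its recursion. -/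
noncomputable def wallisRatio : ℕ → ℝ
  | 0 => 1
  | k + 1 => wallisRatio k * (2 * k + 2) / (2 * k + 1)

lemma wallisRatio_pos (k : ℕ) : 0 < wallisRatio k := by
  induction k with
  | zero => simp [wallisRatio]
  | succ k ih => rw [wallisRatio]; positivity

lemma wallisRatio_succ_mul (k : ℕ) :
    wallisRatio (k + 1) * (2 * k + 1) = wallisRatio k * (2 * k + 2) := by
  rw [wallisRatio]; field_simp

/-- The even power `sin ^ (2k)`, normalized to have the same integral on `[0, π / 2]` for
all `k`. -/
noncomputable def sinPow (k : ℕ) (x : ℝ) : ℝ := wallisRatio k * sin x ^ (2 * k)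

/-- The derivative of `sinPow (k + 1)`. -/
noncomputable def sinPowDeriv (k : ℕ) (x : ℝ) : ℝ :=
  wallisRatio (k + 1) * ((2 * k + 2) * sin x ^ (2 * k + 1) * cos x)

lemma sinPow_zero : sinPow 0 = fun _ => 1 := by
  funext x; simp [sinPow, wallisRatio]

lemma sinPow_nonneg (k : ℕ) (x : ℝ) : 0 ≤ sinPow k x :=
  mul_nonneg (wallisRatio_pos k).le (by rw [pow_mul]; positivity)

lemma sinPow_succ_zero (k : ℕ) : sinPow (k + 1) 0 = 0 := by
  simp [sinPow]

@[fun_prop]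
lemma continuous_sinPow (k : ℕ) : Continuous (sinPow k) := by
  unfold sinPow; fun_prop

@[fun_prop]
lemma continuous_sinPowDeriv (k : ℕ) : Continuous (sinPowDeriv k) := by
  unfold sinPowDeriv; fun_prop

lemma hasDerivAt_sinPow (k : ℕ) (x : ℝ) :
    HasDerivAt (sinPow (k + 1)) (sinPowDeriv k x) x := by
  have h := ((hasDerivAt_sin x).pow (2 * (k + 1))).const_mul (wallisRatio (k + 1))
  refine h.congr_deriv ?_
  rw [sinPowDeriv, show 2 * (k + 1) - 1 = 2 * k + 1 by omega]
  push_cast; ring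

/-- The Wallis normalization is what gives both powers of the sine the same coefficient. -/
lemma hasDerivAt_sinPowDeriv (k : ℕ) (x : ℝ) :
    HasDerivAt (sinPowDeriv k) (4 * (k + 1) ^ 2 * (sinPow k x - sinPow (k + 1) x)) x := by
  have h := (((((hasDerivAt_sin x).pow (2 * k + 1)).const_mul (2 * (k : ℝ) + 2)).mul
    (hasDerivAt_cos x))).const_mul (wallisRatio (k + 1))
  refine h.congr_deriv ?_
  have hw := wallisRatio_succ_mul k
  have hc : cos x ^ 2 = 1 - sin x ^ 2 := by rw [cos_sq']
  simp only [sinPow, Nat.add_sub_cancel, Pi.pow_apply]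
  rw [show 2 * (k + 1) = 2 * k + 2 by ring]
  push_cast
  linear_combination (2 * (k : ℝ) + 2) * sin x ^ (2 * k) * hw
    + wallisRatio (k + 1) * (2 * k + 2) * (2 * k + 1) * sin x ^ (2 * k) * hc

/-- The divided power `(π - 2x) ^ b / b!`. -/
noncomputable def divPow (b : ℕ) (x : ℝ) : ℝ := (π - 2 * x) ^ b / (factorial b : ℝ)

@[fun_prop]
lemma continuous_divPow (b : ℕ) : Continuous (divPow b) := by
  unfold divPow; fun_prop

lemma hasDerivAt_divPow (b : ℕ) (x : ℝ) : HasDerivAt (divPow (b + 1)) (-2 * divPow b x) x := by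
  have h := ((((hasDerivAt_id x).const_mul 2).const_sub π).pow (b + 1)).div_const
    (factorial (b + 1) : ℝ)
  refine h.congr_deriv ?_
  simp only [divPow, id, Nat.add_sub_cancel, Nat.factorial_succ]
  have : (factorial b : ℝ) ≠ 0 := by positivity
  push_cast
  field_simp

lemma divPow_succ_pi_div_two (b : ℕ) : divPow (b + 1) (π / 2) = 0 := by
  simp [divPow, mul_div_cancel₀]

lemma divPow_nonneg (b : ℕ) {x : ℝ} (hx : x ≤ π / 2) : 0 ≤ divPow b x := by
  have : 0 ≤ π - 2 * x := by linarith
  unfold divPow; positivity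

/-- The integral which represents the tails of the series `ζ({2}^b)`. -/
noncomputable def twosTail (b k : ℕ) : ℝ :=
  2 / π * ∫ x in (0 : ℝ)..π / 2, sinPow k x * divPow (2 * b) x

lemma twosTail_nonneg (b k : ℕ) : 0 ≤ twosTail b k := by
  refine mul_nonneg (by positivity) (integral_nonneg (by positivity) fun x hx => ?_)
  exact mul_nonneg (sinPow_nonneg _ _) (divPow_nonneg _ hx.2)

lemma integral_sinPow (k : ℕ) : ∫ x in (0 : ℝ)..π / 2, sinPow k x = π / 2 := by
  induction k with
  | zero => simp [sinPow_zero]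
  | succ k ih =>
    have h := integral_eq_sub_of_hasDerivAt (a := 0) (b := π / 2)
      (fun x _ => hasDerivAt_sinPowDeriv k x) (by
        apply Continuous.intervalIntegrable; fun_prop)
    rw [intervalIntegral.integral_const_mul, intervalIntegral.integral_sub
      ((continuous_sinPow _).intervalIntegrable _ _)
      ((continuous_sinPow _).intervalIntegrable _ _), ih] at h
    have h0 : (4 : ℝ) * (k + 1) ^ 2 ≠ 0 := by positivity
    simp only [sinPowDeriv, cos_pi_div_two, sin_zero] at h
    have : π / 2 - ∫ x in (0 : ℝ)..π / 2, sinPow (k + 1) x = 0 := by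
      apply mul_left_cancel₀ h0
      rw [h]; simp
    linarith

lemma twosTail_zero_left (k : ℕ) : twosTail 0 k = 1 := by
  have : π ≠ 0 := pi_ne_zero
  simp only [twosTail, divPow]
  simp [integral_sinPow]

/-- Two integrations by parts. The boundary terms vanish at 0 through the sine and at `π/2` through
the divided powers. -/
lemma twosTail_sub (b k : ℕ) :
    twosTail (b + 1) k - twosTail (b + 1) (k + 1)
      = twosTail b (k + 1) / ((k + 1 : ℕ) : ℝ) ^ 2 := by
  -- This combination makes the mixed terms `sinPowDeriv k * divPow (2b+1)` cancel.
  have hd : ∀ x, HasDerivAt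
      (fun x => sinPowDeriv k x * divPow (2 * b + 2) x
        + 2 * (sinPow (k + 1) x * divPow (2 * b + 1) x))
      (4 * (k + 1) ^ 2 * (sinPow k x * divPow (2 * (b + 1)) x
        - sinPow (k + 1) x * divPow (2 * (b + 1)) x)
        - 4 * (sinPow (k + 1) x * divPow (2 * b) x)) x := by
    intro x
    refine (((hasDerivAt_sinPowDeriv k x).mul (hasDerivAt_divPow (2 * b + 1) x)).add
      (((hasDerivAt_sinPow k x).mul (hasDerivAt_divPow (2 * b) x)).const_mul 2)).congr_deriv ?_
    rw [show 2 * (b + 1) = 2 * b + 1 + 1 by ring]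
    ring
  have h := integral_eq_sub_of_hasDerivAt (a := 0) (b := π / 2) (fun x _ => hd x) (by
    apply Continuous.intervalIntegrable; fun_prop)
  rw [intervalIntegral.integral_sub (by apply Continuous.intervalIntegrable; fun_prop)
      (by apply Continuous.intervalIntegrable; fun_prop),
    intervalIntegral.integral_const_mul, intervalIntegral.integral_const_mul,
    intervalIntegral.integral_sub (by apply Continuous.intervalIntegrable; fun_prop)
      (by apply Continuous.intervalIntegrable; fun_prop)] at h
  rw [divPow_succ_pi_div_two, divPow_succ_pi_div_two, sinPow_succ_zero] at h
  have h0 : sinPowDeriv k 0 = 0 := by simp [sinPowDeriv]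
  rw [h0] at h
  simp only [twosTail]
  push_cast
  have hk : ((k : ℝ) + 1) ≠ 0 := by positivity
  rw [← mul_sub, eq_div_iff (by positivity)]
  linear_combination (2 / π / 4) * h

/-- On `[0, π / 2]`, the distance to `π / 2` is comparable with the cosine. -/
lemma pi_sub_two_mul_le {x : ℝ} (h0 : 0 ≤ x) (h1 : x ≤ π / 2) : π - 2 * x ≤ π * cos x := by
  have h := mul_le_sin (x := π / 2 - x) (by linarith) (by linarith)
  rw [sin_pi_div_two_sub] at h
  have hp := pi_pos
  calc π - 2 * x = π * (2 / π * (π / 2 - x)) := by field_simp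
    _ ≤ π * cos x := by gcongr

lemma integral_sinPow_mul_cos_sq (k : ℕ) :
    ∫ x in (0 : ℝ)..π / 2, sinPow k x * cos x ^ 2 = π / 2 / (2 * k + 2) := by
  have h : ∀ x, sinPow k x * cos x ^ 2
      = sinPow k x - (2 * k + 1) / (2 * k + 2) * sinPow (k + 1) x := by
    intro x
    have hw := wallisRatio_succ_mul k
    have : wallisRatio k = wallisRatio (k + 1) * (2 * k + 1) / (2 * k + 2) := by
      rw [hw]; field_simp
    simp only [sinPow]
    rw [cos_sq', this, show 2 * (k + 1) = 2 * k + 2 by ring]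
    ring
  simp only [h]
  rw [intervalIntegral.integral_sub (by apply Continuous.intervalIntegrable; fun_prop)
      (by apply Continuous.intervalIntegrable; fun_prop),
    intervalIntegral.integral_const_mul, integral_sinPow, integral_sinPow]
  field_simp
  ring

/-- Since `π - 2x ≤ π cos x`, the weight is at most a constant times `cos²`. Against `cos²` the
integrals of `sinPow k` are a difference of nearly equal quantities, of order `1/k`. -/
lemma tendsto_twosTail_succ (b : ℕ) : Tendsto (twosTail (b + 1)) atTop (𝓝 0) := by
  have hbound : ∀ k, twosTail (b + 1) k ≤ π ^ (2 * (b + 1)) * (1 / ((k : ℝ) + 1)) := by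
    intro k
    have h1 : ∫ x in (0 : ℝ)..π / 2, sinPow k x * divPow (2 * (b + 1)) x
        ≤ ∫ x in (0 : ℝ)..π / 2, π ^ (2 * (b + 1)) * (sinPow k x * cos x ^ 2) := by
      refine integral_mono_on (by positivity) (by apply Continuous.intervalIntegrable; fun_prop)
        (by apply Continuous.intervalIntegrable; fun_prop) fun x hx => ?_
      have hc : 0 ≤ cos x := cos_nonneg_of_neg_pi_div_two_le_of_le
        (by linarith [hx.1, pi_pos]) hx.2
      have hp : 0 ≤ π - 2 * x := by linarith [hx.2]
      have h2 : divPow (2 * (b + 1)) x ≤ π ^ (2 * (b + 1)) * cos x ^ 2 := by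
        calc divPow (2 * (b + 1)) x ≤ (π - 2 * x) ^ (2 * (b + 1)) := by
              refine div_le_self (by positivity) ?_
              exact_mod_cast Nat.one_le_iff_ne_zero.2 (Nat.factorial_ne_zero _)
          _ ≤ (π * cos x) ^ (2 * (b + 1)) := by
              gcongr; exact pi_sub_two_mul_le hx.1 hx.2
          _ = π ^ (2 * (b + 1)) * cos x ^ (2 * (b + 1)) := by rw [mul_pow]
          _ ≤ π ^ (2 * (b + 1)) * cos x ^ 2 := by
              gcongr ?_ * ?_
              exact pow_le_pow_of_le_one hc (cos_le_one x) (by omega)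
      calc sinPow k x * divPow (2 * (b + 1)) x
          ≤ sinPow k x * (π ^ (2 * (b + 1)) * cos x ^ 2) :=
            mul_le_mul_of_nonneg_left h2 (sinPow_nonneg _ _)
        _ = _ := by ring
    rw [intervalIntegral.integral_const_mul, integral_sinPow_mul_cos_sq] at h1
    have hp := pi_pos
    calc twosTail (b + 1) k ≤ 2 / π * (π ^ (2 * (b + 1)) * (π / 2 / (2 * k + 2))) := by
          unfold twosTail; gcongr
      _ = π ^ (2 * (b + 1)) * (1 / (2 * k + 2)) := by field_simp
      _ ≤ π ^ (2 * (b + 1)) * (1 / ((k : ℝ) + 1)) := by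
          refine mul_le_mul_of_nonneg_left (one_div_le_one_div_of_le (by positivity) ?_)
            (by positivity)
          linarith [(Nat.cast_nonneg k : (0 : ℝ) ≤ k)]
  refine squeeze_zero (fun k => twosTail_nonneg _ _) hbound ?_
  simpa using tendsto_one_div_add_atTop_nhds_zero_nat.const_mul (π ^ (2 * (b + 1)))

lemma twosTail_zero_right (d : ℕ) : twosTail d 0 = π ^ (2 * d) / (factorial (2 * d + 1) : ℝ) := by
  have h := integral_eq_sub_of_hasDerivAt (a := 0) (b := π / 2)
    (fun x _ => hasDerivAt_divPow (2 * d) x) (by apply Continuous.intervalIntegrable; fun_prop)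
  rw [intervalIntegral.integral_const_mul, divPow_succ_pi_div_two] at h
  have h2 : divPow (2 * d + 1) 0 = π * (π ^ (2 * d) / (factorial (2 * d + 1) : ℝ)) := by
    simp only [divPow]; rw [mul_zero, sub_zero, pow_succ]; ring
  rw [h2] at h
  have hp := pi_ne_zero
  simp only [twosTail, sinPow_zero, one_mul]
  rw [div_mul_eq_mul_div, div_eq_iff hp]
  linarith

lemma hasSum_tailTerm_twos (d N : ℕ) : HasSum (tailTerm N (twos d)) (twosTail d N) := by
  induction d generalizing N with
  | zero => rw [twosTail_zero_left]; exact hasSum_tailTerm_nil N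
  | succ d ih =>
    refine hasSum_tailTerm_cons (f := twosTail d) (fun n _ => ih n) ?_
    exact hasSum_of_sub_eq (t := fun n => twosTail d n / (n : ℝ) ^ 2) (tendsto_twosTail_succ d)
      (fun n => div_nonneg (twosTail_nonneg _ _) (by positivity)) (twosTail_sub d) N

/-! ### The cotangent weight, double primitives and the tails of `H(r, s)`. -/

/-- The weight in the integral representation of `ζ({2}^r, 3, {2}^b)`. -/
noncomputable def cotWeight (b : ℕ) (x : ℝ) : ℝ := divPow (2 * b + 1) x * (cos x / sin x)

/-- Multiplication by the cotangent turns `sinPow (k+1)` into its derivative over `2(k+1)`; one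
integration by parts then suffices. -/
lemma integral_sinPow_mul_cotWeight (b k : ℕ) :
    2 / π * ∫ x in (0 : ℝ)..π / 2, sinPow (k + 1) x * cotWeight b x
      = twosTail b (k + 1) / ((k + 1 : ℕ) : ℝ) := by
  have hu : ∀ x, sinPow (k + 1) x * cotWeight b x
      = sinPowDeriv k x * divPow (2 * b + 1) x / (2 * (k + 1)) := by
    intro x
    simp only [sinPow, cotWeight, sinPowDeriv]
    rw [show 2 * (k + 1) = 2 * k + 1 + 1 by ring]
    by_cases hs : sin x = 0
    · simp [hs]
    · field_simp
      ring
  have hd : ∀ x, HasDerivAt (fun x => sinPow (k + 1) x * divPow (2 * b + 1) x)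
      (sinPowDeriv k x * divPow (2 * b + 1) x - 2 * (sinPow (k + 1) x * divPow (2 * b) x)) x := by
    intro x
    refine ((hasDerivAt_sinPow k x).mul (hasDerivAt_divPow (2 * b) x)).congr_deriv ?_
    ring
  have h := integral_eq_sub_of_hasDerivAt (a := 0) (b := π / 2) (fun x _ => hd x) (by
    apply Continuous.intervalIntegrable; fun_prop)
  rw [intervalIntegral.integral_sub (by apply Continuous.intervalIntegrable; fun_prop)
      (by apply Continuous.intervalIntegrable; fun_prop),
    intervalIntegral.integral_const_mul, divPow_succ_pi_div_two, sinPow_succ_zero] at h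
  simp only [hu]
  rw [intervalIntegral.integral_div]
  simp only [twosTail]
  push_cast
  have hk : ((k : ℝ) + 1) ≠ 0 := by positivity
  have hp := pi_ne_zero
  field_simp
  linarith

/-- Four times the twofold antiderivative which vanishes at `0` to second order. -/
noncomputable def doublePrimitive (f : ℝ → ℝ) (s : ℝ) : ℝ :=
  4 * ∫ x in (0 : ℝ)..s, ∫ y in (0 : ℝ)..x, f y

lemma continuous_primitive_zero {f : ℝ → ℝ} (hf : Continuous f) :
    Continuous fun x => ∫ y in (0 : ℝ)..x, f y :=
  continuous_iff_continuousAt.2 fun x => (hf.integral_hasStrictDerivAt 0 x).hasDerivAt.continuousAt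

lemma continuous_doublePrimitive {f : ℝ → ℝ} (hf : Continuous f) :
    Continuous (doublePrimitive f) :=
  (continuous_primitive_zero (continuous_primitive_zero hf)).const_mul 4

lemma doublePrimitive_sub {f g : ℝ → ℝ} (hf : Continuous f) (hg : Continuous g) (s : ℝ) :
    doublePrimitive (fun x => f x - g x) s = doublePrimitive f s - doublePrimitive g s := by
  have h : ∀ x : ℝ, ∫ y in (0 : ℝ)..x, (f y - g y)
      = (∫ y in (0 : ℝ)..x, f y) - ∫ y in (0 : ℝ)..x, g y := fun x =>
    intervalIntegral.integral_sub (hf.intervalIntegrable _ _) (hg.intervalIntegrable _ _)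
  simp only [doublePrimitive, h]
  rw [intervalIntegral.integral_sub ((continuous_primitive_zero hf).intervalIntegrable _ _)
    ((continuous_primitive_zero hg).intervalIntegrable _ _), mul_sub]

lemma doublePrimitive_div (f : ℝ → ℝ) (c s : ℝ) :
    doublePrimitive (fun x => f x / c) s = doublePrimitive f s / c := by
  simp only [doublePrimitive, intervalIntegral.integral_div, mul_div_assoc]

lemma doublePrimitive_eq {f F F' : ℝ → ℝ} (hf : Continuous f) (hF : ∀ x, HasDerivAt F (F' x) x)
    (hF' : ∀ x, HasDerivAt F' (f x) x) (h0 : F 0 = 0) (h0' : F' 0 = 0) (s : ℝ) :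
    doublePrimitive f s = 4 * F s := by
  have h1 : ∀ x : ℝ, ∫ y in (0 : ℝ)..x, f y = F' x := fun x => by
    rw [integral_eq_sub_of_hasDerivAt (fun y _ => hF' y) (hf.intervalIntegrable _ _), h0', sub_zero]
  have hc : Continuous F' := continuous_iff_continuousAt.2 fun x => (hF' x).continuousAt
  simp only [doublePrimitive, h1]
  rw [integral_eq_sub_of_hasDerivAt (fun y _ => hF y) (hc.intervalIntegrable _ _), h0, sub_zero]

lemma doublePrimitive_nonneg {f : ℝ → ℝ} {c : ℝ} (hf : ∀ x ∈ Set.Icc 0 c, 0 ≤ f x) :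
    ∀ s ∈ Set.Icc 0 c, 0 ≤ doublePrimitive f s := fun s hs =>
  mul_nonneg (by norm_num) (integral_nonneg hs.1 fun _ hx =>
    integral_nonneg hx.1 fun y hy => hf y ⟨hy.1, hy.2.trans (hx.2.trans hs.2)⟩)

lemma doublePrimitive_monotoneOn {f : ℝ → ℝ} {c : ℝ} (hc : Continuous f)
    (hf : ∀ x ∈ Set.Icc 0 c, 0 ≤ f x) : MonotoneOn (doublePrimitive f) (Set.Icc 0 c) := by
  intro s hs t ht hst
  have hi := continuous_primitive_zero hc
  have h := integral_add_adjacent_intervals (hi.intervalIntegrable (μ := volume) 0 s)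
    (hi.intervalIntegrable s t)
  have h2 : 0 ≤ ∫ x in s..t, ∫ y in (0 : ℝ)..x, f y :=
    integral_nonneg hst fun x hx => integral_nonneg (hs.1.trans hx.1) fun y hy =>
      hf y ⟨hy.1, hy.2.trans (hx.2.trans ht.2)⟩
  simp only [doublePrimitive]
  linarith

lemma doublePrimitive_le {f : ℝ → ℝ} {c : ℝ} (hc : Continuous f)
    (hf : ∀ x ∈ Set.Icc 0 c, 0 ≤ f x) (hm : MonotoneOn f (Set.Icc 0 c)) {s : ℝ}
    (hs : s ∈ Set.Icc 0 c) : doublePrimitive f s ≤ 4 * s ^ 2 * f s := by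
  have h1 : ∀ x ∈ Set.Icc 0 s, ∫ y in (0 : ℝ)..x, f y ≤ s * f s := by
    intro x hx
    calc ∫ y in (0 : ℝ)..x, f y ≤ ∫ y in (0 : ℝ)..x, f s :=
          integral_mono_on hx.1 (hc.intervalIntegrable _ _) (by simp) fun y hy =>
            hm ⟨hy.1, hy.2.trans (hx.2.trans hs.2)⟩ hs (hy.2.trans hx.2)
      _ = x * f s := by simp
      _ ≤ s * f s := mul_le_mul_of_nonneg_right hx.2 (hf s hs)
  have h2 : ∫ x in (0 : ℝ)..s, ∫ y in (0 : ℝ)..x, f y ≤ ∫ x in (0 : ℝ)..s, s * f s :=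
    integral_mono_on hs.1 ((continuous_primitive_zero hc).intervalIntegrable _ _) (by simp) h1
  rw [intervalIntegral.integral_const, sub_zero, smul_eq_mul] at h2
  simp only [doublePrimitive]
  linarith

/-- The iterated double primitives of `sinPow N`. -/
noncomputable def iterSinPow (N : ℕ) : ℕ → ℝ → ℝ
  | 0 => sinPow N
  | r + 1 => doublePrimitive (iterSinPow N r)

lemma continuous_iterSinPow (N r : ℕ) : Continuous (iterSinPow N r) := by
  induction r with
  | zero => exact continuous_sinPow N
  | succ r ih => exact continuous_doublePrimitive ih

lemma sinPow_monotoneOn (N : ℕ) : MonotoneOn (sinPow N) (Set.Icc 0 (π / 2)) := by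
  intro x hx y hy hxy
  have h1 : sin x ≤ sin y := sin_le_sin_of_le_of_le_pi_div_two (by linarith [hx.1, pi_pos]) hy.2 hxy
  have h0 : 0 ≤ sin x := sin_nonneg_of_nonneg_of_le_pi hx.1 (by linarith [hx.2, pi_pos])
  exact mul_le_mul_of_nonneg_left (pow_le_pow_left₀ h0 h1 _) (wallisRatio_pos N).le

lemma iterSinPow_nonneg_monotoneOn (N r : ℕ) :
    (∀ x ∈ Set.Icc 0 (π / 2), 0 ≤ iterSinPow N r x) ∧
      MonotoneOn (iterSinPow N r) (Set.Icc 0 (π / 2)) := by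
  induction r with
  | zero => exact ⟨fun x _ => sinPow_nonneg N x, sinPow_monotoneOn N⟩
  | succ r ih => exact ⟨doublePrimitive_nonneg ih.1,
      doublePrimitive_monotoneOn (continuous_iterSinPow N r) ih.1⟩

lemma iterSinPow_le (N r : ℕ) {x : ℝ} (hx : x ∈ Set.Icc 0 (π / 2)) :
    iterSinPow N r x ≤ (4 * x ^ 2) ^ r * sinPow N x := by
  induction r with
  | zero => simp [iterSinPow]
  | succ r ih =>
    obtain ⟨h1, h2⟩ := iterSinPow_nonneg_monotoneOn N r
    calc iterSinPow N (r + 1) x ≤ 4 * x ^ 2 * iterSinPow N r x :=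
          doublePrimitive_le (continuous_iterSinPow N r) h1 h2 hx
      _ ≤ 4 * x ^ 2 * ((4 * x ^ 2) ^ r * sinPow N x) := by gcongr
      _ = _ := by ring

/-- One factor `x²` is kept to absorb the pole of the cotangent; the others are bounded by
constants. -/
lemma iterSinPow_succ_le (N r : ℕ) {x : ℝ} (hx : x ∈ Set.Icc 0 (π / 2)) :
    iterSinPow N (r + 1) x ≤ 4 * (π ^ 2) ^ r * x ^ 2 * sinPow N x := by
  have h1 : 4 * x ^ 2 ≤ π ^ 2 := by nlinarith [hx.1, hx.2, pi_pos]
  have h0 := sinPow_nonneg N x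
  calc iterSinPow N (r + 1) x ≤ (4 * x ^ 2) ^ (r + 1) * sinPow N x := iterSinPow_le N (r + 1) hx
    _ = (4 * x ^ 2) ^ r * (4 * x ^ 2) * sinPow N x := by ring
    _ ≤ (π ^ 2) ^ r * (4 * x ^ 2) * sinPow N x := by gcongr
    _ = _ := by ring

/-- `sinPow (N+1)` and its derivative vanish at 0, so the double primitive recovers it from its
second derivative. Linearity carries the identity to all `r`. -/
lemma iterSinPow_sub (N r : ℕ) (x : ℝ) :
    iterSinPow N (r + 1) x - iterSinPow (N + 1) (r + 1) x
      = iterSinPow (N + 1) r x / ((N + 1 : ℕ) : ℝ) ^ 2 := by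
  induction r generalizing x with
  | zero =>
    simp only [iterSinPow]
    rw [← doublePrimitive_sub (continuous_sinPow _) (continuous_sinPow _)]
    have hN : ((N : ℝ) + 1) ≠ 0 := by positivity
    rw [doublePrimitive_eq (F := fun x => sinPow (N + 1) x / (4 * (N + 1) ^ 2))
      (F' := fun x => sinPowDeriv N x / (4 * (N + 1) ^ 2)) (by fun_prop)
      (fun x => (hasDerivAt_sinPow N x).div_const _)
      (fun x => ((hasDerivAt_sinPowDeriv N x).div_const _).congr_deriv (by field_simp))
      (by simp [sinPow_succ_zero]) (by simp [sinPowDeriv])]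
    push_cast
    field_simp
  | succ r ih =>
    have h := doublePrimitive_sub (continuous_iterSinPow N (r + 1))
      (continuous_iterSinPow (N + 1) (r + 1)) x
    simp only [ih, doublePrimitive_div] at h
    exact h.symm

lemma iterSinPow_zero_left (r : ℕ) (x : ℝ) :
    iterSinPow 0 r x = (2 * x) ^ (2 * r) / (factorial (2 * r) : ℝ) := by
  have hd : ∀ (n : ℕ) (x : ℝ), HasDerivAt
      (fun x : ℝ => (2 * x) ^ (n + 1) / (factorial (n + 1) : ℝ))
      (2 * ((2 * x) ^ n / (factorial n : ℝ))) x := by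
    intro n x
    refine ((((hasDerivAt_id x).const_mul 2).pow (n + 1)).div_const _).congr_deriv ?_
    simp only [id, Nat.add_sub_cancel, Nat.factorial_succ]
    have : (factorial n : ℝ) ≠ 0 := by positivity
    push_cast
    field_simp
  induction r generalizing x with
  | zero => simp [iterSinPow, sinPow_zero]
  | succ r ih =>
    have h : iterSinPow 0 r = fun x => (2 * x) ^ (2 * r) / (factorial (2 * r) : ℝ) := funext ih
    rw [iterSinPow, h, doublePrimitive_eq
      (F := fun x => ((2 * x) ^ (2 * r + 1 + 1) / (factorial (2 * r + 1 + 1) : ℝ)) / 4)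
      (F' := fun x => ((2 * x) ^ (2 * r + 1) / (factorial (2 * r + 1) : ℝ)) / 2) (by fun_prop)
      (fun x => ((hd (2 * r + 1) x).div_const 4).congr_deriv (by ring))
      (fun x => ((hd (2 * r) x).div_const 2).congr_deriv (by ring)) (by simp) (by simp)]
    rw [show 2 * (r + 1) = 2 * r + 1 + 1 by ring]
    ring

lemma cotWeight_nonneg (b : ℕ) {x : ℝ} (hx : x ∈ Set.Icc 0 (π / 2)) : 0 ≤ cotWeight b x := by
  have h1 : 0 ≤ sin x := sin_nonneg_of_nonneg_of_le_pi hx.1 (by linarith [hx.2, pi_pos])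
  have h2 : 0 ≤ cos x := cos_nonneg_of_neg_pi_div_two_le_of_le (by linarith [hx.1, pi_pos]) hx.2
  exact mul_nonneg (divPow_nonneg _ hx.2) (div_nonneg h2 h1)

/-- Near 0, Jordan's inequality `x ≤ (π/2) sin x` controls the pole; near `π/2`, `cos x ≤ π/2 - x`
supplies one more factor `π - 2x`, raising the divided power to an even one. -/
lemma sq_mul_cotWeight_le (b : ℕ) {x : ℝ} (hx : x ∈ Set.Icc 0 (π / 2)) :
    x ^ 2 * cotWeight b x ≤ π ^ 2 * (b + 1) * divPow (2 * (b + 1)) x := by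
  have hp := pi_pos
  have h2 : 0 ≤ cos x := cos_nonneg_of_neg_pi_div_two_le_of_le (by linarith [hx.1, pi_pos]) hx.2
  have h3 : cos x ≤ π / 2 - x := by
    rw [← sin_pi_div_two_sub]; exact sin_le (by linarith [hx.2])
  have h4 : x * (cos x / sin x) ≤ π / 2 * cos x := by
    rcases hx.1.eq_or_lt with h | h
    · simp [← h]; positivity
    · have hs : 0 < sin x := sin_pos_of_pos_of_lt_pi h (by linarith [hx.2])
      have h5 : x ≤ π / 2 * sin x := by
        have := mul_le_sin hx.1 hx.2
        calc x = π / 2 * (2 / π * x) := by field_simp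
          _ ≤ _ := by gcongr
      rw [← mul_div_assoc, div_le_iff₀ hs]
      nlinarith
  have h6 : x ^ 2 * (cos x / sin x) ≤ π ^ 2 / 2 * (π - 2 * x) := by
    have h7 : 0 ≤ π - 2 * x := by linarith [hx.2]
    calc x ^ 2 * (cos x / sin x) = x * (x * (cos x / sin x)) := by ring
      _ ≤ π / 2 * (π / 2 * cos x) := by
          gcongr
          · exact mul_nonneg hx.1 (div_nonneg h2
              (sin_nonneg_of_nonneg_of_le_pi hx.1 (by linarith [hx.2])))
          · exact hx.2
      _ ≤ π / 2 * (π / 2 * (π / 2 - x)) := by gcongr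
      _ = π ^ 2 / 8 * (π - 2 * x) := by ring
      _ ≤ π ^ 2 / 2 * (π - 2 * x) := by gcongr; norm_num
  have h8 : divPow (2 * b + 1) x * (π - 2 * x) = 2 * (b + 1) * divPow (2 * (b + 1)) x := by
    simp only [divPow]
    rw [show 2 * (b + 1) = 2 * b + 1 + 1 by ring, Nat.factorial_succ (2 * b + 1)]
    have : (factorial (2 * b + 1) : ℝ) ≠ 0 := by positivity
    push_cast
    field_simp
    ring
  calc x ^ 2 * cotWeight b x = divPow (2 * b + 1) x * (x ^ 2 * (cos x / sin x)) := by
        rw [cotWeight]; ring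
    _ ≤ divPow (2 * b + 1) x * (π ^ 2 / 2 * (π - 2 * x)) :=
        mul_le_mul_of_nonneg_left h6 (divPow_nonneg _ hx.2)
    _ = π ^ 2 / 2 * (divPow (2 * b + 1) x * (π - 2 * x)) := by ring
    _ = _ := by rw [h8]; ring

lemma measurable_cotWeight (b : ℕ) : Measurable (cotWeight b) := by
  unfold cotWeight
  have := (continuous_divPow (2 * b + 1)).measurable
  fun_prop

lemma intervalIntegrable_mul_cotWeight (b : ℕ) {f : ℝ → ℝ} (hf : Continuous f) {K : ℝ}
    (hK : ∀ x ∈ Set.Icc 0 (π / 2), |f x| ≤ K * x ^ 2) :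
    IntervalIntegrable (fun x => f x * cotWeight b x) volume 0 (π / 2) := by
  have hp := pi_pos
  have hK0 : 0 ≤ K := by
    have h := (abs_nonneg _).trans (hK (π / 2) ⟨by positivity, le_rfl⟩)
    exact nonneg_of_mul_nonneg_left h (by positivity)
  have hg : IntervalIntegrable (fun x => K * (π ^ 2 * (b + 1) * divPow (2 * (b + 1)) x))
      volume 0 (π / 2) := by apply Continuous.intervalIntegrable; fun_prop
  refine hg.mono_fun' (hf.measurable.mul (measurable_cotWeight b)).aestronglyMeasurable ?_
  refine (ae_restrict_iff' measurableSet_uIoc).2 (Eventually.of_forall fun x hx => ?_)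
  rw [Set.uIoc_of_le (by positivity)] at hx
  have hx' : x ∈ Set.Icc 0 (π / 2) := ⟨hx.1.le, hx.2⟩
  have hw := cotWeight_nonneg b hx'
  beta_reduce
  rw [norm_mul, norm_eq_abs, norm_eq_abs, abs_of_nonneg hw]
  calc |f x| * cotWeight b x ≤ K * x ^ 2 * cotWeight b x := by gcongr; exact hK x hx'
    _ = K * (x ^ 2 * cotWeight b x) := by ring
    _ ≤ _ := mul_le_mul_of_nonneg_left (sq_mul_cotWeight_le b hx') hK0

lemma intervalIntegrable_iterSinPow_mul_cotWeight (N r b : ℕ) :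
    IntervalIntegrable (fun x => iterSinPow N (r + 1) x * cotWeight b x) volume 0 (π / 2) := by
  refine intervalIntegrable_mul_cotWeight b (continuous_iterSinPow N (r + 1))
    (K := 4 * (π ^ 2) ^ r * wallisRatio N) fun x hx => ?_
  rw [abs_of_nonneg ((iterSinPow_nonneg_monotoneOn N (r + 1)).1 x hx)]
  have h : sinPow N x ≤ wallisRatio N := by
    refine mul_le_of_le_one_right (wallisRatio_pos N).le ?_
    rw [pow_mul]
    exact pow_le_one₀ (sq_nonneg _) (sin_sq_le_one x)
  calc _ ≤ 4 * (π ^ 2) ^ r * x ^ 2 * sinPow N x := iterSinPow_succ_le N r hx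
    _ ≤ 4 * (π ^ 2) ^ r * x ^ 2 * wallisRatio N := by gcongr
    _ = _ := by ring

/-- The integral which represents the tails of the series `ζ({2}^r, 3, {2}^b)`. -/
noncomputable def hTail (b r N : ℕ) : ℝ :=
  2 / π * ∫ x in (0 : ℝ)..π / 2, iterSinPow N (r + 1) x * cotWeight b x

lemma hTail_nonneg (b r N : ℕ) : 0 ≤ hTail b r N := by
  refine mul_nonneg (by positivity) (integral_nonneg (by positivity) fun x hx => ?_)
  exact mul_nonneg ((iterSinPow_nonneg_monotoneOn N (r + 1)).1 x hx) (cotWeight_nonneg b hx)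

/-- Decay in `N` is inherited from `twosTail (b + 1)`. -/
lemma hTail_le (b r N : ℕ) :
    hTail b r N ≤ 4 * (π ^ 2) ^ r * (π ^ 2 * (b + 1)) * twosTail (b + 1) N := by
  have h : ∫ x in (0 : ℝ)..π / 2, iterSinPow N (r + 1) x * cotWeight b x
      ≤ ∫ x in (0 : ℝ)..π / 2, 4 * (π ^ 2) ^ r * (π ^ 2 * (b + 1)) *
        (sinPow N x * divPow (2 * (b + 1)) x) := by
    refine integral_mono_on (by positivity) (intervalIntegrable_iterSinPow_mul_cotWeight N r b)
      (by apply Continuous.intervalIntegrable; fun_prop) fun x hx => ?_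
    have h0 := sinPow_nonneg N x
    calc _ ≤ 4 * (π ^ 2) ^ r * x ^ 2 * sinPow N x * cotWeight b x :=
          mul_le_mul_of_nonneg_right (iterSinPow_succ_le N r hx) (cotWeight_nonneg b hx)
      _ = 4 * (π ^ 2) ^ r * sinPow N x * (x ^ 2 * cotWeight b x) := by ring
      _ ≤ 4 * (π ^ 2) ^ r * sinPow N x * (π ^ 2 * (b + 1) * divPow (2 * (b + 1)) x) :=
          mul_le_mul_of_nonneg_left (sq_mul_cotWeight_le b hx) (by positivity)
      _ = _ := by ring
  rw [intervalIntegral.integral_const_mul] at h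
  calc hTail b r N ≤ 2 / π * (4 * (π ^ 2) ^ r * (π ^ 2 * (b + 1)) *
        ∫ x in (0 : ℝ)..π / 2, sinPow N x * divPow (2 * (b + 1)) x) :=
        mul_le_mul_of_nonneg_left h (by positivity)
    _ = _ := by rw [twosTail]; ring

lemma tendsto_hTail (b r : ℕ) : Tendsto (hTail b r) atTop (𝓝 0) := by
  refine squeeze_zero (hTail_nonneg b r) (hTail_le b r) ?_
  simpa using (tendsto_twosTail_succ b).const_mul (4 * (π ^ 2) ^ r * (π ^ 2 * ((b : ℝ) + 1)))

lemma hTail_sub_eq_integral (b r N : ℕ) :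
    hTail b r N - hTail b r (N + 1) = (2 / π *
      ∫ x in (0 : ℝ)..π / 2, iterSinPow (N + 1) r x * cotWeight b x) / ((N + 1 : ℕ) : ℝ) ^ 2 := by
  rw [hTail, hTail, ← mul_sub, ← intervalIntegral.integral_sub
    (intervalIntegrable_iterSinPow_mul_cotWeight N r b)
    (intervalIntegrable_iterSinPow_mul_cotWeight (N + 1) r b), mul_div_assoc,
    ← intervalIntegral.integral_div]
  congr 2
  funext x
  rw [← sub_mul, iterSinPow_sub]
  ring

/-- In the base case the entry 3 splits as 2 + 1: `1/n²` from the double primitive, `1/n` from the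
cotangent. -/
lemma hasSum_tailTerm_hIndex (b r N : ℕ) : HasSum (tailTerm N (hIndex r b)) (hTail b r N) := by
  induction r generalizing N with
  | zero =>
    refine hasSum_tailTerm_cons (f := twosTail b) (fun n _ => hasSum_tailTerm_twos b n) ?_
    refine hasSum_of_sub_eq (t := fun n => twosTail b n / (n : ℝ) ^ 3) (tendsto_hTail b 0)
      (fun n => div_nonneg (twosTail_nonneg _ _) (by positivity)) (fun n => ?_) N
    rw [hTail_sub_eq_integral]
    simp only [iterSinPow]
    rw [integral_sinPow_mul_cotWeight, div_div, ← pow_succ']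
  | succ r ih =>
    refine hasSum_tailTerm_cons (f := hTail b r) (fun n _ => ih n) ?_
    exact hasSum_of_sub_eq (t := fun n => hTail b r n / (n : ℝ) ^ 2) (tendsto_hTail b (r + 1))
      (fun n => div_nonneg (hTail_nonneg _ _ _) (by positivity))
      (fun n => hTail_sub_eq_integral b (r + 1) n) N

/-! ### Polynomials against the Fourier series of the cotangent. -/

/-- The Riemann-Lebesgue lemma on `[0, π / 2]`, along odd frequencies. -/
lemma tendsto_integral_mul_cos_odd {g : ℝ → ℝ}
    (hg : IntervalIntegrable g volume 0 (π / 2)) :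
    Tendsto (fun N : ℕ => ∫ x in (0 : ℝ)..π / 2, g x * cos ((2 * N + 1) * x)) atTop (𝓝 0) := by
  have hp := pi_pos
  have hle : (0 : ℝ) ≤ π / 2 := by positivity
  set f : ℝ → ℂ := (Set.Ioc 0 (π / 2)).indicator fun x => (g x : ℂ) with hf
  have hfi : Integrable f := by
    rw [hf, integrable_indicator_iff measurableSet_Ioc]
    exact ((intervalIntegrable_iff_integrableOn_Ioc_of_le hle).1 hg).ofReal
  -- The Fourier character is `exp(2πi ·)`, so frequency `(2N+1)/(2π)` yields `cos((2N+1)x)` as real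
  -- part.
  have hw : Tendsto (fun N : ℕ => (2 * (N : ℝ) + 1) / (2 * π)) atTop (cocompact ℝ) := by
    refine Tendsto.mono_right ?_ atTop_le_cocompact
    refine Tendsto.atTop_div_const (by positivity) ?_
    exact tendsto_atTop_add_const_right _ _
      (tendsto_natCast_atTop_atTop.const_mul_atTop (by norm_num))
  have h := (Complex.continuous_re.tendsto 0).comp
    ((Real.tendsto_integral_exp_smul_cocompact f).comp hw)
  rw [Complex.zero_re] at h
  refine h.congr fun N => ?_
  simp only [Function.comp_apply]
  have hi : Integrable fun v : ℝ =>
      Real.fourierChar (-(v * ((2 * (N : ℝ) + 1) / (2 * π)))) • f v := by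
    simpa [mul_comm] using
      (Real.fourierIntegral_convergent_iff ((2 * (N : ℝ) + 1) / (2 * π))).2 hfi
  rw [← Complex.reCLM_apply, ← Complex.reCLM.integral_comp_comm hi]
  rw [intervalIntegral.integral_of_le hle, ← MeasureTheory.integral_indicator measurableSet_Ioc]
  congr 1
  funext x
  by_cases hx : x ∈ Set.Ioc 0 (π / 2)
  · rw [hf, Set.indicator_of_mem hx, Set.indicator_of_mem hx, Circle.smul_def,
      Real.fourierChar_apply, smul_eq_mul, Complex.reCLM_apply, Complex.re_mul_ofReal,
      Complex.exp_ofReal_mul_I_re, mul_comm, ← cos_neg]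
    congr 2
    field_simp
  · simp [hf, hx]

/-- Finite form of `cot x = 2 ∑ sin 2nx`, with a remainder suited to Riemann-Lebesgue. -/
lemma sum_two_mul_sin_mul_sin (N : ℕ) (x : ℝ) :
    (∑ n ∈ Finset.range N, 2 * sin (2 * ((n + 1 : ℕ) : ℝ) * x)) * sin x
      = cos x - cos ((2 * N + 1) * x) := by
  induction N with
  | zero => simp
  | succ N ih =>
    rw [Finset.sum_range_succ, add_mul, ih]
    have h1 : cos ((2 * N + 1) * x)
        = cos (2 * ((N + 1 : ℕ) : ℝ) * x) * cos x + sin (2 * ((N + 1 : ℕ) : ℝ) * x) * sin x := by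
      rw [← cos_sub]; congr 1; push_cast; ring
    have h2 : cos ((2 * ((N + 1 : ℕ) : ℝ) + 1) * x)
        = cos (2 * ((N + 1 : ℕ) : ℝ) * x) * cos x - sin (2 * ((N + 1 : ℕ) : ℝ) * x) * sin x := by
      rw [← cos_add]; congr 1; ring
    rw [h1, h2]; ring

/-- Integration of a polynomial with a double zero at `0` against the Fourier series of the
cotangent. -/
lemma tendsto_sum_integral_sin (Q : Polynomial ℝ) :
    Tendsto (fun N : ℕ => ∑ n ∈ Finset.range N,
      2 * ∫ x in (0 : ℝ)..π / 2, (Polynomial.X ^ 2 * Q).eval (2 * x)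
        * sin (2 * ((n + 1 : ℕ) : ℝ) * x)) atTop
      (𝓝 (∫ x in (0 : ℝ)..π / 2, (Polynomial.X ^ 2 * Q).eval (2 * x) * (cos x / sin x))) := by
  have hp := pi_pos
  set P := Polynomial.X ^ 2 * Q with hP
  have hgc : ContinuousOn (fun x => P.eval (2 * x) / sin x) (Set.uIcc 0 (π / 2)) := by
    -- The double zero of `P` cancels the zero of the sine; `sinc` makes the continuity at 0
    -- visible.
    have h1 : (fun x => P.eval (2 * x) / sin x) = fun x => 4 * x * Q.eval (2 * x) / sinc x := by
      funext x
      by_cases hx : x = 0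
      · simp [hx]
      · rw [sinc_of_ne_zero hx, hP]
        simp only [Polynomial.eval_mul, Polynomial.eval_pow, Polynomial.eval_X]
        by_cases hs : sin x = 0
        · simp [hs]
        · field_simp
          ring
    rw [h1]
    refine ContinuousOn.div (by fun_prop) continuous_sinc.continuousOn fun x hx => ?_
    rw [Set.uIcc_of_le (by positivity)] at hx
    by_cases h0 : x = 0
    · simp [h0]
    · rw [sinc_of_ne_zero h0]
      have : 0 < x := lt_of_le_of_ne hx.1 (Ne.symm h0)
      exact (div_pos (sin_pos_of_pos_of_lt_pi this (by linarith [hx.2])) this).ne'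
  have hg := hgc.intervalIntegrable (μ := volume)
  have hlim := (tendsto_integral_mul_cos_odd hg).const_sub
    (∫ x in (0 : ℝ)..π / 2, P.eval (2 * x) * (cos x / sin x))
  rw [sub_zero] at hlim
  refine hlim.congr fun N => ?_
  have hcot : IntervalIntegrable (fun x => P.eval (2 * x) * (cos x / sin x)) volume 0 (π / 2) := by
    refine (hgc.mul continuous_cos.continuousOn).intervalIntegrable.congr ?_
    exact fun x _ => by rw [Pi.mul_apply]; ring
  have hN : IntervalIntegrable (fun x => P.eval (2 * x) / sin x * cos ((2 * N + 1) * x))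
      volume 0 (π / 2) :=
    (hgc.mul (Continuous.continuousOn (by fun_prop))).intervalIntegrable
  rw [← intervalIntegral.integral_sub hcot hN]
  simp only [← intervalIntegral.integral_const_mul]
  rw [← intervalIntegral.integral_finsetSum
    (fun n _ => by apply Continuous.intervalIntegrable; fun_prop)]
  refine intervalIntegral.integral_congr fun x hx => ?_
  rw [Set.uIcc_of_le (by positivity)] at hx
  have hsum : ∑ n ∈ Finset.range N, 2 * (P.eval (2 * x) * sin (2 * ((n + 1 : ℕ) : ℝ) * x))
      = P.eval (2 * x) * ∑ n ∈ Finset.range N, 2 * sin (2 * ((n + 1 : ℕ) : ℝ) * x) := by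
    rw [Finset.mul_sum]
    exact Finset.sum_congr rfl fun _ _ => by ring
  rw [hsum]
  by_cases h0 : x = 0
  · simp [h0]
  · have : 0 < x := lt_of_le_of_ne hx.1 (Ne.symm h0)
    have hs : sin x ≠ 0 := (sin_pos_of_pos_of_lt_pi this (by linarith [hx.2])).ne'
    rw [eq_div_of_mul_eq hs (sum_two_mul_sin_mul_sin N x)]
    ring

/-- After two integrations by parts, `sin(nπ) = 0` removes the boundary terms in `P'`. -/
lemma integral_eval_mul_sin (P : Polynomial ℝ) {n : ℕ} (hn : n ≠ 0) :
    2 * ∫ x in (0 : ℝ)..π / 2, P.eval (2 * x) * sin (2 * (n : ℝ) * x)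
      = (P.eval 0 - (-1) ^ n * P.eval π) / n
        - 1 / (n : ℝ) ^ 2 * (2 * ∫ x in (0 : ℝ)..π / 2,
          (Polynomial.derivative^[2] P).eval (2 * x) * sin (2 * (n : ℝ) * x)) := by
  have hn' : (n : ℝ) ≠ 0 := by exact_mod_cast hn
  have h2 : ∀ (R : Polynomial ℝ) (x : ℝ),
      HasDerivAt (fun x => R.eval (2 * x)) (2 * R.derivative.eval (2 * x)) x := by
    intro R x
    refine ((R.hasDerivAt (2 * x)).comp x ((hasDerivAt_id x).const_mul 2)).congr_deriv ?_
    ring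
  have hs : ∀ x : ℝ, HasDerivAt (fun x => sin (2 * (n : ℝ) * x))
      (cos (2 * (n : ℝ) * x) * (2 * n)) x := fun x => by
    simpa using ((hasDerivAt_id x).const_mul (2 * (n : ℝ))).sin
  have hc : ∀ x : ℝ, HasDerivAt (fun x => cos (2 * (n : ℝ) * x))
      (-sin (2 * (n : ℝ) * x) * (2 * n)) x := fun x => by
    simpa using ((hasDerivAt_id x).const_mul (2 * (n : ℝ))).cos
  have hd : ∀ x : ℝ, HasDerivAt
      (fun x => P.derivative.eval (2 * x) * sin (2 * (n : ℝ) * x) / n ^ 2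
        - P.eval (2 * x) * cos (2 * (n : ℝ) * x) / n)
      (2 * (P.eval (2 * x) * sin (2 * (n : ℝ) * x))
        + 1 / (n : ℝ) ^ 2 * (2 * ((Polynomial.derivative^[2] P).eval (2 * x)
          * sin (2 * (n : ℝ) * x)))) x := by
    intro x
    refine ((((h2 P.derivative x).mul (hs x)).div_const _).sub
      (((h2 P x).mul (hc x)).div_const _)).congr_deriv ?_
    simp only [Function.iterate_succ, Function.iterate_zero, Function.comp_apply, id]
    field_simp
    ring
  have h := integral_eq_sub_of_hasDerivAt (a := 0) (b := π / 2) (fun x _ => hd x) (by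
    apply Continuous.intervalIntegrable; fun_prop)
  rw [intervalIntegral.integral_add (by apply Continuous.intervalIntegrable; fun_prop)
      (by apply Continuous.intervalIntegrable; fun_prop),
    intervalIntegral.integral_const_mul, intervalIntegral.integral_const_mul,
    intervalIntegral.integral_const_mul] at h
  have e1 : 2 * (n : ℝ) * (π / 2) = n * π := by ring
  have e2 : 2 * (π / 2) = π := by ring
  rw [e1, e2, sin_nat_mul_pi, cos_nat_mul_pi] at h
  simp only [mul_zero, sin_zero, cos_zero, zero_div, mul_one, zero_sub] at h
  rw [eq_sub_iff_add_eq, h]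
  ring

lemma integral_eval_mul_sin_eq_sum (M : ℕ) (P : Polynomial ℝ) (hP : P.natDegree < 2 * M) {n : ℕ}
    (hn : n ≠ 0) :
    2 * ∫ x in (0 : ℝ)..π / 2, P.eval (2 * x) * sin (2 * (n : ℝ) * x)
      = ∑ j ∈ Finset.range M, (-1) ^ j * ((Polynomial.derivative^[2 * j] P).eval 0
        - (-1) ^ n * (Polynomial.derivative^[2 * j] P).eval π) / (n : ℝ) ^ (2 * j + 1) := by
  have hn' : (n : ℝ) ≠ 0 := by exact_mod_cast hn
  have key : ∀ M : ℕ, 2 * ∫ x in (0 : ℝ)..π / 2, P.eval (2 * x) * sin (2 * (n : ℝ) * x)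
      = (∑ j ∈ Finset.range M, (-1) ^ j * ((Polynomial.derivative^[2 * j] P).eval 0
        - (-1) ^ n * (Polynomial.derivative^[2 * j] P).eval π) / (n : ℝ) ^ (2 * j + 1))
        + (-1) ^ M / (n : ℝ) ^ (2 * M) * (2 * ∫ x in (0 : ℝ)..π / 2,
          (Polynomial.derivative^[2 * M] P).eval (2 * x) * sin (2 * (n : ℝ) * x)) := by
    intro M
    induction M with
    | zero => simp
    | succ M ih =>
      rw [ih, Finset.sum_range_succ, integral_eval_mul_sin _ hn, ← Function.iterate_add_apply,
        show 2 + 2 * M = 2 * (M + 1) by ring]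
      field_simp
      ring
  rw [key M, Polynomial.iterate_derivative_eq_zero hP]
  simp

lemma hasSum_alternating {k : ℕ} {Z : ℝ}
    (hZ : HasSum (fun n : ℕ => 1 / (n : ℝ) ^ k) Z) :
    HasSum (fun n : ℕ => (-1) ^ n / (n : ℝ) ^ k) (-(1 - 2 / 2 ^ k) * Z) := by
  have he : HasSum (fun n : ℕ => 1 / ((2 * n : ℕ) : ℝ) ^ k) (Z / 2 ^ k) := by
    convert! hZ.div_const (2 ^ k) using 1
    funext n
    push_cast
    rw [mul_pow, div_div, mul_comm]
  have ho : Summable (fun n : ℕ => 1 / ((2 * n + 1 : ℕ) : ℝ) ^ k) :=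
    hZ.summable.comp_injective (i := fun n => 2 * n + 1) fun a b h => by
      simp only at h; omega
  have h1 := (HasSum.even_add_odd (f := fun n : ℕ => 1 / (n : ℝ) ^ k) he ho.hasSum).unique hZ
  have h2 := HasSum.even_add_odd (f := fun n : ℕ => (-1) ^ n / (n : ℝ) ^ k)
    (m := Z / 2 ^ k) (m' := -∑' n : ℕ, 1 / ((2 * n + 1 : ℕ) : ℝ) ^ k)
    (by simpa [pow_mul] using he) (by simpa [pow_mul, pow_succ, neg_div] using ho.hasSum.neg)
  convert! h2 using 1
  rw [eq_sub_of_add_eq' h1]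
  ring

/-- The sum `∑ 1 / n ^ k` over the positive integers. -/
noncomputable def zetaSum (k : ℕ) : ℝ := ∑' n : ℕ, 1 / (n : ℝ) ^ k

lemma riemannZeta_eq_zetaSum {k : ℕ} (hk : 1 < k) : riemannZeta k = (zetaSum k : ℂ) := by
  rw [zeta_nat_eq_tsum_of_gt_one hk, zetaSum, Complex.ofReal_tsum]
  push_cast
  rfl

lemma integral_eval_mul_cot (Q : Polynomial ℝ) (M : ℕ)
    (hdeg : (Polynomial.X ^ 2 * Q).natDegree < 2 * (M + 1))
    (hpi : (Polynomial.X ^ 2 * Q).eval π = 0) :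
    ∫ x in (0 : ℝ)..π / 2, (Polynomial.X ^ 2 * Q).eval (2 * x) * (cos x / sin x)
      = ∑ j ∈ Finset.range M, (-1) ^ (j + 1) *
        ((Polynomial.derivative^[2 * (j + 1)] (Polynomial.X ^ 2 * Q)).eval 0
          + (1 - 1 / 2 ^ (2 * (j + 1)))
            * (Polynomial.derivative^[2 * (j + 1)] (Polynomial.X ^ 2 * Q)).eval π)
        * zetaSum (2 * (j + 1) + 1) := by
  have hlim := tendsto_sum_integral_sin Q
  set P := Polynomial.X ^ 2 * Q with hP
  have h0 : P.eval 0 = 0 := by simp [hP]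
  refine tendsto_nhds_unique hlim ?_
  simp only [integral_eval_mul_sin_eq_sum (M + 1) P hdeg (Nat.succ_ne_zero _)]
  -- The `j = 0` term, which would involve exponent 1, drops out because `P` vanishes at 0 and `π`.
  have hcomm : ∀ N : ℕ, ∑ n ∈ Finset.range N, ∑ j ∈ Finset.range (M + 1),
      (-1) ^ j * ((Polynomial.derivative^[2 * j] P).eval 0
        - (-1) ^ (n + 1) * (Polynomial.derivative^[2 * j] P).eval π)
        / ((n + 1 : ℕ) : ℝ) ^ (2 * j + 1)
      = ∑ j ∈ Finset.range M, ∑ n ∈ Finset.range N,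
      (-1) ^ (j + 1) * ((Polynomial.derivative^[2 * (j + 1)] P).eval 0
        - (-1) ^ (n + 1) * (Polynomial.derivative^[2 * (j + 1)] P).eval π)
        / ((n + 1 : ℕ) : ℝ) ^ (2 * (j + 1) + 1) := by
    intro N
    rw [Finset.sum_comm, Finset.sum_range_succ']
    simp [h0, hpi]
  simp only [Nat.succ_eq_add_one, hcomm]
  refine tendsto_finsetSum _ fun j _ => HasSum.tendsto_sum_nat ?_
  have hZ : HasSum (fun n : ℕ => 1 / (n : ℝ) ^ (2 * (j + 1) + 1)) (zetaSum (2 * (j + 1) + 1)) :=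
    (Real.summable_one_div_nat_pow.2 (by omega)).hasSum
  set A := (Polynomial.derivative^[2 * (j + 1)] P).eval 0
  set B := (Polynomial.derivative^[2 * (j + 1)] P).eval π
  have h := ((hZ.mul_left A).sub ((hasSum_alternating hZ).mul_left B)).mul_left ((-1) ^ (j + 1))
  -- Shifts to `n ≥ 1`; the discarded `n = 0` term is 0, as division by zero gives 0.
  have h' := (hasSum_nat_add_iff' 1).2 h
  convert! h' using 1
  · funext n
    ring
  · have : (2 : ℝ) / 2 ^ (2 * (j + 1) + 1) = 1 / 2 ^ (2 * (j + 1)) := by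
      rw [pow_succ]; field_simp
    rw [this]
    simp
    ring

/-! ### Endpoint derivatives of the polynomial and the final formula. -/

lemma eval_iterate_derivative (P : Polynomial ℝ) (c : ℝ) (k : ℕ) :
    (Polynomial.derivative^[k] P).eval c = factorial k * (Polynomial.taylor c P).coeff k := by
  rw [Polynomial.taylor_coeff, ← Polynomial.factorial_smul_hasseDeriv]
  simp

lemma factorial_div_mul_choose {m n k : ℕ} (hm : m ≤ k) (hk : k ≤ m + n) :
    (factorial k : ℝ) / (factorial m * factorial n) * (n.choose (k - m))
      = k.choose m / factorial (m + n - k) := by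
  rw [Nat.cast_choose ℝ hm, Nat.cast_choose ℝ (by omega : k - m ≤ n),
    show n - (k - m) = m + n - k by omega]
  have h1 : (factorial m : ℝ) ≠ 0 := by positivity
  have h2 : (factorial n : ℝ) ≠ 0 := by positivity
  have h3 : (factorial (k - m) : ℝ) ≠ 0 := by positivity
  have h4 : (factorial (m + n - k) : ℝ) ≠ 0 := by positivity
  field_simp

/-- The polynomial `X ^ 2 * momentPoly m n` is `X ^ (m + 2) / (m + 2)! * (π - X) ^ n / n!`. -/
noncomputable def momentPoly (m n : ℕ) : Polynomial ℝ :=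
  Polynomial.C (1 / ((factorial (m + 2) : ℝ) * factorial n)) *
    (Polynomial.X ^ m * (Polynomial.C π - Polynomial.X) ^ n)

lemma eval_momentPoly (m n : ℕ) (x : ℝ) :
    (Polynomial.X ^ 2 * momentPoly m n).eval x
      = x ^ (m + 2) / factorial (m + 2) * ((π - x) ^ n / factorial n) := by
  simp only [momentPoly, Polynomial.eval_mul, Polynomial.eval_pow, Polynomial.eval_X,
    Polynomial.eval_C, Polynomial.eval_sub]
  have h1 : (factorial (m + 2) : ℝ) ≠ 0 := by positivity
  have h2 : (factorial n : ℝ) ≠ 0 := by positivity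
  field_simp
  ring

lemma natDegree_momentPoly_le (m n : ℕ) :
    (Polynomial.X ^ 2 * momentPoly m n).natDegree ≤ m + n + 2 := by
  unfold momentPoly
  compute_degree
  omega

/-- The sign from `(π - X)^n = -(X - π)^n` cancels that of the odd power of `-π` in the binomial
expansion. -/
lemma eval_zero_iterate_derivative_momentPoly (m : ℕ) {n k : ℕ} (hn : Odd n)
    (hk : k ≤ m + 2 + n) (ho : Odd (m + 2 + n - k)) :
    (Polynomial.derivative^[k] (Polynomial.X ^ 2 * momentPoly m n)).eval 0
      = k.choose (m + 2) * (π ^ (m + 2 + n - k) / factorial (m + 2 + n - k)) := by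
  have hP : Polynomial.X ^ 2 * momentPoly m n
      = Polynomial.C (-(1 / ((factorial (m + 2) : ℝ) * factorial n))) *
        (Polynomial.X ^ (m + 2) * (Polynomial.X - Polynomial.C π) ^ n) := by
    rw [momentPoly, ← neg_sub Polynomial.X, hn.neg_pow, Polynomial.C_neg]
    ring
  rw [eval_iterate_derivative, Polynomial.taylor_zero, hP, Polynomial.coeff_C_mul,
    Polynomial.coeff_X_pow_mul']
  split_ifs with h
  · rw [sub_eq_add_neg, ← Polynomial.C_neg, Polynomial.coeff_X_add_C_pow,
      show n - (k - (m + 2)) = m + 2 + n - k by omega,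
      ho.neg_pow]
    have := factorial_div_mul_choose h hk
    linear_combination π ^ (m + 2 + n - k) * this
  · rw [Nat.choose_eq_zero_of_lt (by omega)]; simp

/-- Recentred at `π`, the factor `π - X` becomes `-X`, so only the sign of its odd power survives.
-/
lemma eval_pi_iterate_derivative_momentPoly (m : ℕ) {n k : ℕ} (hn : Odd n)
    (hk : k ≤ m + 2 + n) :
    (Polynomial.derivative^[k] (Polynomial.X ^ 2 * momentPoly m n)).eval π
      = -(k.choose n * (π ^ (m + 2 + n - k) / factorial (m + 2 + n - k))) := by
  have hP : Polynomial.taylor π (Polynomial.X ^ 2 * momentPoly m n)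
      = Polynomial.C (-(1 / ((factorial (m + 2) : ℝ) * factorial n))) *
        (Polynomial.X ^ n * (Polynomial.X + Polynomial.C π) ^ (m + 2)) := by
    have h : Polynomial.C π - (Polynomial.X + Polynomial.C π) = -Polynomial.X := by ring
    rw [momentPoly, Polynomial.taylor_apply, Polynomial.C_neg]
    simp only [Polynomial.mul_comp, Polynomial.pow_comp, Polynomial.X_comp, Polynomial.C_comp,
      Polynomial.sub_comp]
    rw [h, hn.neg_pow]
    ring
  rw [eval_iterate_derivative, hP, Polynomial.coeff_C_mul, Polynomial.coeff_X_pow_mul']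
  split_ifs with h
  · rw [Polynomial.coeff_X_add_C_pow, show m + 2 - (k - n) = m + 2 + n - k by omega]
    have := factorial_div_mul_choose (n := m + 2) h (by omega)
    rw [add_comm n (m + 2)] at this
    linear_combination -π ^ (m + 2 + n - k) * this
  · rw [Nat.choose_eq_zero_of_lt (by omega)]; simp

/-- Zagier's formula for the integral representing `ζ({2}^r, 3, {2}^s)`. -/
lemma hTail_zero (s r : ℕ) :
    hTail s r 0 = 2 * ∑ k ∈ Finset.Icc 1 (r + s + 1),
      (-1) ^ k * (zagierCoeff k r s : ℝ) * zetaSum (2 * k + 1) * twosTail (r + s + 1 - k) 0 := by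
  have hp := pi_ne_zero
  have hI : ∫ x in (0 : ℝ)..π / 2, iterSinPow 0 (r + 1) x * cotWeight s x
      = ∫ x in (0 : ℝ)..π / 2, (Polynomial.X ^ 2 * momentPoly (2 * r) (2 * s + 1)).eval (2 * x)
        * (cos x / sin x) := by
    congr 1
    funext x
    rw [eval_momentPoly, iterSinPow_zero_left, cotWeight, divPow,
      show 2 * (r + 1) = 2 * r + 2 by ring]
    ring
  have hodd : Odd (2 * s + 1) := ⟨s, rfl⟩
  rw [hTail, hI, integral_eval_mul_cot _ (r + s + 1)
    ((natDegree_momentPoly_le _ _).trans_lt (by omega)) (by rw [eval_momentPoly]; simp)]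
  have hIcc : Finset.Icc 1 (r + s + 1) = Finset.Ico 1 (r + s + 1 + 1) := by
    ext; simp
  rw [hIcc, Finset.sum_Ico_eq_sum_range, Finset.mul_sum, Finset.mul_sum, Nat.add_sub_cancel]
  refine Finset.sum_congr rfl fun j hj => ?_
  rw [Finset.mem_range] at hj
  -- The exponent of `π` is `2d + 1` with `d = r+s+1-k`, `k = j+1`; the prefactor `2/π` removes one
  -- `π`, leaving `ζ({2}^d)`.
  have he : 2 * r + 2 + (2 * s + 1) - 2 * (j + 1) = 2 * (r + s + 1 - (j + 1)) + 1 := by omega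
  rw [eval_zero_iterate_derivative_momentPoly _ hodd (by omega) (he ▸ ⟨_, rfl⟩),
    eval_pi_iterate_derivative_momentPoly _ hodd (by omega), he, add_comm 1 j,
    twosTail_zero_right, zagierCoeff]
  push_cast
  rw [pow_succ π]
  field_simp
  ring

end

/-- The multiple zeta series involved converge (absolutely), and their values satisfy Zagier's
formula. -/
theorem theorem1p1 (r s : ℕ) :
    Summable (mzvTerm (hIndex r s)) ∧
    (∀ d : ℕ, Summable (mzvTerm (twos d))) ∧
    (zagierH r s : ℂ) =
      2 * ∑ k ∈ Finset.Icc 1 (r + s + 1),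
        (-1 : ℂ) ^ k * (zagierCoeff k r s : ℂ) * riemannZeta (2 * (k : ℂ) + 1) *
          (mzv (twos (r + s + 1 - k)) : ℂ) := by
  have hH : HasSum (mzvTerm (hIndex r s)) (hTail s r 0) := hasSum_tailTerm_hIndex s r 0
  have hT : ∀ d, HasSum (mzvTerm (twos d)) (twosTail d 0) := fun d => hasSum_tailTerm_twos d 0
  refine ⟨hH.summable, fun d => (hT d).summable, ?_⟩
  have hz : zagierH r s = hTail s r 0 := hH.tsum_eq
  have ht : ∀ d, mzv (twos d) = twosTail d 0 := fun d => (hT d).tsum_eq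
  simp only [hz, ht, hTail_zero]
  push_cast
  congr 1
  refine Finset.sum_congr rfl fun k hk => ?_
  have hk1 := (Finset.mem_Icc.1 hk).1
  rw [← riemannZeta_eq_zetaSum (by omega)]
  push_cast
  rfl
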